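/- **Proposition.** Let $K$ be a finite field, let $s\ge 1$, and let $A_1,\dots,A_s\subseteq K$ be subsets with $d_i=|A_i|$ such that (i) $\{0,1\}\subseteq A_i$ for all $i$; (ii) $a/b\in A_j$ whenever $1\le i<j\le s$, $a\in A_j$ and $0\ne b\in A_i$; (iii) $d_1\le\cdots\le d_s$. Let $\mathcal X=[A_1\times\cdots\times A_s]\subseteq\mathbb P^{s-1}(K)$ be the image of $(A_1\times\cdots\times A_s)\setminus\{0\}$ under $x\mapsto[x]$ (a projective nested cartesian set), and write $\mathcal X=\{[P_1],\dots,[P_m]\}$ with $m=|\mathcal X|$. For $d\ge 0$ let $S_d$ be the space of homogeneous polynomials of degree $d$ in $K[t_1,\dots,t_s]$ (including $0$), choose $f_1,\dots,f_m\in S_d$ with $f_i(P_i)\neq0$, let $C_{\mathcal X}(d)$ be the image of the linear map $S_d\to K^m$, $f\mapsto\big(f(P_1)/f_1(P_1),\dots,f(P_m)/f_m(P_m)\big)$, and let $\delta_{\mathcal X}(d)$ be the minimum number of non-zero entries of a non-zero vector of $C_{\mathcal X}(d)$. Then, for every choice of the $f_i$, $$\delta_{\mathcal X}(1)=d_2\cdots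 d_s$$ (an empty product is $1$). Consequently the Carvalho–Lopez-Neumann–López conjecture holds for $d=1$, that is, for $d=1$ one has $$\delta_{\mathcal X}(d)=\begin{cases}(d_{k+2}-\ell+1)\,d_{k+3}\cdots d_s & \text{if } d\le\sum_{i=2}^s(d_i-1),\\ 1 & \text{if } d\ge\sum_{i=2}^s(d_i-1)+1,\end{cases}$$ where, in the first case, $0\le k\le s-2$ and $\ell$ are integers with $d=\sum_{i=2}^{k+1}(d_i-1)+\ell$ and $1\le\ell\le d_{k+2}-1$. -/

import Mathlib

open scoped LinearAlgebra.Projectivization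

/-- The image `[A_1 × ⋯ × A_s]` of `A_1 × ⋯ × A_s \ {0}` in the projective space `ℙ^{s-1}` over `K`
(coordinates are indexed by `Fin s`, so `A_i` is `A (i - 1)`). -/
def projCartesianSet {K : Type*} [Field K] {s : ℕ} (A : Fin s → Finset K) :
    Set (ℙ K (Fin s → K)) :=
  {P | ∃ (x : Fin s → K) (hx : x ≠ 0), (∀ i, x i ∈ A i) ∧ P = Projectivization.mk K x hx}

/-- The conditions on `A_1, …, A_s` under which `[A_1 × ⋯ × A_s]` is called a
projective nested cartesian set. -/
structure IsProjNested {K : Type*} [Field K] {s : ℕ} (A : Fin s → Finset K) : Prop where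
  zero_mem : ∀ i, (0 : K) ∈ A i
  one_mem : ∀ i, (1 : K) ∈ A i
  div_mem : ∀ i j, i < j → ∀ a ∈ A j, ∀ b ∈ A i, b ≠ 0 → a / b ∈ A j
  card_mono : ∀ i j, i ≤ j → (A i).card ≤ (A j).card

/-- Admissible denominators for the evaluation map in degree `d` on `X`: for each point `P` of `X`
a form `f_P` of degree `d` that does not vanish at `P`. -/
structure IsDenominatorFamily {K : Type*} [Field K] {s : ℕ} (X : Set (ℙ K (Fin s → K))) (d : ℕ)
    (f : X → MvPolynomial (Fin s) K) : Prop where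
  homogeneous : ∀ P, (f P).IsHomogeneous d
  eval_ne_zero : ∀ P, MvPolynomial.eval P.1.rep (f P) ≠ 0

/-- The evaluation map `g ↦ (g(P) / f_P(P))_{P ∈ X}` on forms of degree `d`. For homogeneous `f_P`
of degree `d` each quotient is independent of the representative of `P`. -/
noncomputable def projEval {K : Type*} [Field K] {s : ℕ} (X : Set (ℙ K (Fin s → K))) (d : ℕ)
    (f : X → MvPolynomial (Fin s) K) :
    MvPolynomial.homogeneousSubmodule (Fin s) K d →ₗ[K] (X → K) where
  toFun g P := MvPolynomial.eval P.1.rep g.1 / MvPolynomial.eval P.1.rep (f P)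
  map_add' g h := by
    funext P
    simp [add_div]
  map_smul' c g := by
    funext P
    simp [MvPolynomial.smul_eval, mul_div_assoc]

/-- The projective Reed-Muller-type code of degree `d` on `X`, the image of the evaluation map. -/
noncomputable def projReedMullerCode {K : Type*} [Field K] {s : ℕ} (X : Set (ℙ K (Fin s → K)))
    (d : ℕ) (f : X → MvPolynomial (Fin s) K) : Submodule K (X → K) :=
  LinearMap.range (projEval X d f)

open Classical in
/-- The minimum distance of a linear code: the least Hamming weight of a nonzero codeword
(`0` if the code is zero). -/
noncomputable def codeMinDist {K : Type*} [Field K] {ι : Type*} [Finite ι]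
    (C : Submodule K (ι → K)) : ℕ :=
  letI := Fintype.ofFinite ι
  sInf {w | ∃ v ∈ C, v ≠ 0 ∧ hammingNorm v = w}

/-- The assertion that `δ` is the value predicted in degree `d` by the conjecture of Carvalho,
Lopez-Neumann and López for cardinalities `d_1, …, d_s` (`n i` is `d_{i+1}`, indices from `0`):
`(d_{k+2} - ℓ + 1) d_{k+3} ⋯ d_s` if `d ≤ ∑_{i=2}^s (d_i - 1)`, where `0 ≤ k ≤ s - 2`,
`d = ∑_{i=2}^{k+1} (d_i - 1) + ℓ` and `1 ≤ ℓ ≤ d_{k+2} - 1`; and `1` for larger `d`. -/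
def IsConjecturedMinDist {s : ℕ} (n : Fin s → ℕ) (d δ : ℕ) : Prop :=
  (d ≤ (∑ i with 1 ≤ i.val, (n i - 1)) →
    ∃ (k ℓ : ℕ) (hk : k + 1 < s),
      d = (∑ i with 1 ≤ i.val ∧ i.val ≤ k, (n i - 1)) + ℓ ∧
      1 ≤ ℓ ∧ ℓ ≤ n ⟨k + 1, hk⟩ - 1 ∧
      δ = (n ⟨k + 1, hk⟩ - ℓ + 1) * ∏ i with k + 2 ≤ i.val, n i) ∧
  ((∑ i with 1 ≤ i.val, (n i - 1)) + 1 ≤ d → δ = 1)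

/-! The lower bound is an induction on the number of coordinates, over normalized vectors (first
nonzero entry `1`), which represent distinct projective points. Split them by first coordinate. On
the slice `x_1 = 1` a form involving some later variable becomes a nontrivial affine equation, with
at most `d_3 ⋯ d_s` zeros among `d_2 ⋯ d_s` points; on the slice `x_1 = 0` induction gives at least
`d_3 ⋯ d_s` nonzeros, which makes up exactly that loss. The form `t_1` attains the bound: by the
division condition its nonzeros are the points `[1 : y]` with `y` in `A_2 × ⋯ × A_s`. -/

/-- The number of solutions of a nontrivial linear equation in a grid whose sides have weakly
increasing sizes is at most the product of all side lengths except the first. -/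
theorem card_linear_eq_on_grid_le {K : Type*} [Field K] [DecidableEq K] {n : ℕ}
    (A : Fin (n + 1) → Finset K) (hmono : ∀ i j, i ≤ j → (A i).card ≤ (A j).card)
    (c : Fin (n + 1) → K) (hc : c ≠ 0) (e : K) :
    ((Fintype.piFinset A).filter (fun x => e + ∑ i, c i * x i = 0)).card
      ≤ ∏ i : Fin n, (A i.succ).card := by
  obtain ⟨j, hj⟩ : ∃ j, c j ≠ 0 := Function.ne_iff.mp hc
  calc _ ≤ (Fintype.piFinset fun i => A (j.succAbove i)).card := by
        -- Since `c j ≠ 0`, the equation determines `x j` from the other coordinates.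
        refine Finset.card_le_card_of_injOn (fun x i => x (j.succAbove i)) ?_ ?_
        · intro x hx
          simp only [Finset.coe_filter, Fintype.mem_piFinset, Set.mem_ofPred_eq] at hx
          simpa using fun i => hx.1 (j.succAbove i)
        · intro x hx y hy hxy
          simp only [Finset.coe_filter, Set.mem_ofPred_eq] at hx hy
          have hrest : ∀ i, x (j.succAbove i) = y (j.succAbove i) := fun i => congrFun hxy i
          have hsum := hx.2.trans hy.2.symm
          rw [Fin.sum_univ_succAbove _ j, Fin.sum_univ_succAbove _ j] at hsum
          simp only [hrest, add_right_inj, add_left_inj] at hsum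
          funext i
          rcases Fin.eq_self_or_eq_succAbove j i with rfl | ⟨k, rfl⟩
          · exact mul_left_cancel₀ hj hsum
          · exact hrest k
    _ = ∏ i, (A (j.succAbove i)).card := Fintype.card_piFinset _
    -- Omitting index `0`, a smallest side, leaves the largest product: `j.succAbove i ≤ i.succ`.
    _ ≤ _ := Finset.prod_le_prod' fun i _ => hmono _ _ (by
        rw [Fin.succAbove]
        split_ifs
        exacts [Fin.castSucc_lt_succ.le, le_rfl])

/-- A nonzero vector is normalized if its first nonzero coordinate is `1`. -/
def IsNormalizedVector {K : Type*} [Field K] {s : ℕ} (x : Fin s → K) : Prop :=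
  ∃ k, x k = 1 ∧ ∀ i < k, x i = 0

theorem IsNormalizedVector.ne_zero {K : Type*} [Field K] {s : ℕ} {x : Fin s → K}
    (hx : IsNormalizedVector x) : x ≠ 0 := by
  rintro rfl
  obtain ⟨k, hk, -⟩ := hx
  exact zero_ne_one hk

theorem IsNormalizedVector.cons_one {K : Type*} [Field K] {s : ℕ} (x : Fin s → K) :
    IsNormalizedVector (Fin.cons 1 x : Fin (s + 1) → K) :=
  ⟨0, rfl, fun i hi => absurd hi (Fin.not_lt_zero i)⟩

theorem IsNormalizedVector.cons_zero {K : Type*} [Field K] {s : ℕ} {x : Fin s → K}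
    (hx : IsNormalizedVector x) : IsNormalizedVector (Fin.cons 0 x : Fin (s + 1) → K) := by
  obtain ⟨k, hk, h⟩ := hx
  refine ⟨k.succ, by simpa using hk, fun i => ?_⟩
  cases i using Fin.cases with
  | zero => simp
  | succ i => simpa using h i

/-- Scaling by `a ≠ 0` preserves the position of the first nonzero entry; both entries there are
`1`, so `a = 1`. Hence normalized vectors inject into projective space. -/
theorem IsNormalizedVector.eq_of_smul_eq {K : Type*} [Field K] {s : ℕ} {x y : Fin s → K}
    (hx : IsNormalizedVector x) (hy : IsNormalizedVector y) {a : K} (ha : a ≠ 0)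
    (h : a • y = x) : x = y := by
  obtain ⟨k, hk, hk'⟩ := hx
  obtain ⟨l, hl, hl'⟩ := hy
  subst h
  simp only [Pi.smul_apply, smul_eq_mul] at hk hk'
  have hkl : k = l := by
    rcases lt_trichotomy k l with h | h | h
    · simp [hl' k h] at hk
    · exact h
    · exact absurd (hk' l h) (by simp [hl, ha])
  subst hkl
  rw [hl, mul_one] at hk
  rw [hk, one_smul]

/-- A nonzero linear form is nonzero at no fewer than `d_2 ⋯ d_s` of the normalized vectors in a
grid whose sides contain `0` and `1` and have weakly increasing sizes. -/
theorem exists_normalized_linear_ne_zero {K : Type*} [Field K] {n : ℕ} :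
    ∀ (A : Fin (n + 1) → Finset K), (∀ i, (0 : K) ∈ A i) → (∀ i, (1 : K) ∈ A i) →
      (∀ i j, i ≤ j → (A i).card ≤ (A j).card) → ∀ c : Fin (n + 1) → K, c ≠ 0 →
      ∃ T : Finset (Fin (n + 1) → K),
        (∀ x ∈ T, IsNormalizedVector x ∧ (∀ i, x i ∈ A i) ∧ ∑ i, c i * x i ≠ 0) ∧
        ∏ i : Fin n, (A i.succ).card ≤ T.card := by
  classical
  induction n with
  | zero =>
    intro A _ h1 _ c hc
    refine ⟨{fun _ => 1}, ?_, by simp⟩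
    have hc0 : c 0 ≠ 0 := fun h => hc (funext fun i => by simpa [Fin.fin_one_eq_zero i] using h)
    simp only [Finset.mem_singleton, forall_eq]
    exact ⟨⟨0, rfl, fun i hi => absurd hi (Fin.not_lt_zero i)⟩, h1, by simpa using hc0⟩
  | succ n ih =>
    intro A h0 h1 hmono c hc
    have hcons : ∀ a : K, Function.Injective
        (fun x : Fin (n + 1) → K => (Fin.cons a x : Fin (n + 2) → K)) :=
      fun a => Fin.cons_right_injective (α := fun _ => K) a
    have hmono' : ∀ i j : Fin (n + 1), i ≤ j → (A i.succ).card ≤ (A j.succ).card :=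
      fun i j hij => hmono _ _ (Fin.succ_le_succ_iff.mpr hij)
    have hgrid : ∀ (a : K) (x : Fin (n + 1) → K), a ∈ A 0 → (∀ i, x i ∈ A i.succ) →
        ∀ i, (Fin.cons a x : Fin (n + 2) → K) i ∈ A i := by
      intro a x ha hx i
      cases i using Fin.cases with
      | zero => simpa using ha
      | succ i => simpa using hx i
    -- If only `c 0` survives, the slice `x 0 = 1` already suffices, and the affine equation there
    -- would be degenerate.
    by_cases hc' : (fun i : Fin (n + 1) => c i.succ) = 0
    · have hs : ∀ i : Fin (n + 1), c i.succ = 0 := fun i => congrFun hc' i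
      have hc0 : c 0 ≠ 0 := by
        refine fun h => hc (funext fun i => ?_)
        cases i using Fin.cases with
        | zero => exact h
        | succ i => exact hs i
      refine ⟨(Fintype.piFinset fun i => A i.succ).image (fun x => Fin.cons 1 x), ?_, ?_⟩
      · intro y hy
        obtain ⟨x, hx, rfl⟩ := Finset.mem_image.mp hy
        refine ⟨.cons_one x, hgrid _ _ (h1 0) (Fintype.mem_piFinset.mp hx), ?_⟩
        simpa [Fin.sum_univ_succ, hs] using hc0
      · rw [Finset.card_image_of_injective _ (hcons 1), Fintype.card_piFinset]
    · obtain ⟨T, hT, hTcard⟩ := ih (fun i => A i.succ) (fun i => h0 _) (fun i => h1 _) hmono'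
        (fun i => c i.succ) hc'
      have hzero := card_linear_eq_on_grid_le (fun i => A i.succ) hmono' _ hc' (c 0)
      set G := Fintype.piFinset fun i : Fin (n + 1) => A i.succ with hG
      have hsplit := Finset.card_filter_add_card_filter_not (s := G)
        (fun x => c 0 + ∑ i, c i.succ * x i = 0)
      have hGcard : G.card = ∏ i : Fin (n + 1), (A i.succ).card := Fintype.card_piFinset _
      refine ⟨(G.filter fun x => ¬ (c 0 + ∑ i, c i.succ * x i = 0)).image
        (fun x => Fin.cons 1 x) ∪ T.image (fun x => Fin.cons 0 x), ?_, ?_⟩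
      · intro y hy
        rcases Finset.mem_union.mp hy with hy | hy <;>
          obtain ⟨x, hx, rfl⟩ := Finset.mem_image.mp hy
        · rw [Finset.mem_filter, hG, Fintype.mem_piFinset] at hx
          refine ⟨.cons_one x, hgrid _ _ (h1 0) hx.1, ?_⟩
          simpa [Fin.sum_univ_succ (n := n + 1)] using hx.2
        · obtain ⟨hn, hm, hne⟩ := hT x hx
          refine ⟨hn.cons_zero, hgrid _ _ (h0 0) hm, ?_⟩
          simpa [Fin.sum_univ_succ (n := n + 1)] using hne
      · rw [Finset.card_union_of_disjoint, Finset.card_image_of_injective _ (hcons 1),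
          Finset.card_image_of_injective _ (hcons 0)]
        -- The slice `x 0 = 1` contributes at least `G.card` minus the zero bound in `hzero`;
        -- `hTcard` restores that same product.
        · omega
        · rw [Finset.disjoint_left]
          intro y hy hy'
          obtain ⟨x, -, rfl⟩ := Finset.mem_image.mp hy
          obtain ⟨z, -, hz⟩ := Finset.mem_image.mp hy'
          simpa using congrFun hz 0

theorem MvPolynomial.IsHomogeneous.exists_eval_eq_sum {R σ : Type*} [CommRing R] [Fintype σ]
    {g : MvPolynomial σ R} (hg : g.IsHomogeneous 1) :
    ∃ c : σ → R, ∀ x, MvPolynomial.eval x g = ∑ i, c i * x i := by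
  have hmem : g ∈ MvPolynomial.homogeneousSubmodule σ R 1 := hg
  rw [MvPolynomial.homogeneousSubmodule_one_eq_span_X,
    Submodule.mem_span_range_iff_exists_fun] at hmem
  obtain ⟨c, rfl⟩ := hmem
  exact ⟨c, fun x => by simp [MvPolynomial.smul_eval]⟩

theorem projEval_ne_zero_iff {K : Type*} [Field K] {s d : ℕ} {X : Set (ℙ K (Fin s → K))}
    {f : X → MvPolynomial (Fin s) K} (hf : IsDenominatorFamily X d f)
    (g : MvPolynomial.homogeneousSubmodule (Fin s) K d) (P : X) :
    projEval X d f g P ≠ 0 ↔ MvPolynomial.eval P.1.rep g.1 ≠ 0 := by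
  simp [projEval, hf.eval_ne_zero P]

theorem prod_card_le_hammingNorm_projEval {K : Type*} [Field K] {n : ℕ}
    {A : Fin (n + 1) → Finset K} (hA : IsProjNested A) [Fintype (projCartesianSet A)]
    [DecidableEq K] {f : projCartesianSet A → MvPolynomial (Fin (n + 1)) K}
    (hf : IsDenominatorFamily (projCartesianSet A) 1 f)
    (g : MvPolynomial.homogeneousSubmodule (Fin (n + 1)) K 1)
    (hg : projEval (projCartesianSet A) 1 f g ≠ 0) :
    ∏ i : Fin n, (A i.succ).card ≤ hammingNorm (projEval (projCartesianSet A) 1 f g) := by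
  obtain ⟨c, hc⟩ := MvPolynomial.IsHomogeneous.exists_eval_eq_sum (g := g.1) g.2
  have hc0 : c ≠ 0 := by
    rintro rfl
    obtain ⟨P, hP⟩ := Function.ne_iff.mp hg
    exact (projEval_ne_zero_iff hf g P).mp hP (by simp [hc])
  obtain ⟨T, hT, hcard⟩ :=
    exists_normalized_linear_ne_zero A hA.zero_mem hA.one_mem hA.card_mono c hc0
  refine hcard.trans ?_
  rw [← Finset.card_attach]
  refine Finset.card_le_card_of_injOn
    (fun x => ⟨Projectivization.mk K x.1 (hT x.1 x.2).1.ne_zero,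
      x.1, (hT x.1 x.2).1.ne_zero, (hT x.1 x.2).2.1, rfl⟩) ?_ ?_
  · intro x _
    obtain ⟨a, ha⟩ := Projectivization.exists_smul_eq_mk_rep K x.1 (hT x.1 x.2).1.ne_zero
    simp only [Finset.coe_filter, Finset.mem_univ, true_and, Set.mem_ofPred_eq]
    rw [projEval_ne_zero_iff hf, hc, ← ha]
    have : ∑ i, c i * (a • x.1) i = a * ∑ i, c i * x.1 i := by
      rw [Finset.mul_sum]
      exact Finset.sum_congr rfl fun i _ => by
        rw [Pi.smul_apply, Units.smul_def, smul_eq_mul]; ring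
    rw [this]
    exact mul_ne_zero a.ne_zero (hT x.1 x.2).2.2
  · intro x _ y _ hxy
    obtain ⟨a, ha⟩ := (Projectivization.mk_eq_mk_iff K _ _ (hT x.1 x.2).1.ne_zero
      (hT y.1 y.2).1.ne_zero).mp (congrArg Subtype.val hxy)
    exact Subtype.ext ((hT x.1 x.2).1.eq_of_smul_eq (hT y.1 y.2).1 a.ne_zero ha)

/-- Dehomogenizing at coordinate `0` is injective where it is nonzero, and `div_mem` keeps the
quotients inside the grid. -/
theorem hammingNorm_projEval_X_zero_le {K : Type*} [Field K] {n : ℕ}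
    {A : Fin (n + 1) → Finset K} (hA : IsProjNested A) [Fintype (projCartesianSet A)]
    [DecidableEq K] {f : projCartesianSet A → MvPolynomial (Fin (n + 1)) K}
    (hf : IsDenominatorFamily (projCartesianSet A) 1 f) :
    hammingNorm (projEval (projCartesianSet A) 1 f
      ⟨MvPolynomial.X 0, MvPolynomial.isHomogeneous_X K 0⟩) ≤ ∏ i : Fin n, (A i.succ).card := by
  rw [← Fintype.card_piFinset]
  refine Finset.card_le_card_of_injOn (fun P i => P.1.rep i.succ / P.1.rep 0) ?_ ?_
  · rintro ⟨P, x, hx, hxA, rfl⟩ hP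
    simp only [Finset.coe_filter, Finset.mem_univ, true_and, Set.mem_ofPred_eq] at hP
    rw [projEval_ne_zero_iff hf] at hP
    obtain ⟨a, ha⟩ := Projectivization.exists_smul_eq_mk_rep K x hx
    simp only [MvPolynomial.eval_X, ← ha, Pi.smul_apply, Units.smul_def, smul_eq_mul] at hP
    rw [Finset.mem_coe, Fintype.mem_piFinset]
    intro i
    simp only [← ha, Pi.smul_apply, Units.smul_def, smul_eq_mul]
    rw [mul_div_mul_left _ _ a.ne_zero]
    exact hA.div_mem 0 i.succ i.succ_pos _ (hxA _) _ (hxA _) (right_ne_zero_of_mul hP)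
  · intro P hP Q hQ hPQ
    simp only [Finset.coe_filter, Finset.mem_univ, true_and, Set.mem_ofPred_eq] at hP hQ
    rw [projEval_ne_zero_iff hf, MvPolynomial.eval_X] at hP hQ
    refine Subtype.ext ?_
    rw [← P.1.mk_rep, ← Q.1.mk_rep, Projectivization.mk_eq_mk_iff']
    refine ⟨P.1.rep 0 / Q.1.rep 0, funext fun i => ?_⟩
    rw [Pi.smul_apply, smul_eq_mul]
    cases i using Fin.cases with
    | zero => field_simp
    | succ i =>
      have h : P.1.rep i.succ / P.1.rep 0 = Q.1.rep i.succ / Q.1.rep 0 := congrFun hPQ i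
      field_simp at h ⊢
      linear_combination -h

theorem projEval_X_zero_ne_zero {K : Type*} [Field K] {n : ℕ}
    {A : Fin (n + 1) → Finset K} (hA : IsProjNested A)
    {f : projCartesianSet A → MvPolynomial (Fin (n + 1)) K}
    (hf : IsDenominatorFamily (projCartesianSet A) 1 f) :
    projEval (projCartesianSet A) 1 f
      ⟨MvPolynomial.X 0, MvPolynomial.isHomogeneous_X K 0⟩ ≠ 0 := by
  have hne : (fun _ => 1 : Fin (n + 1) → K) ≠ 0 := fun h => one_ne_zero (congrFun h 0)
  refine Function.ne_iff.mpr
    ⟨⟨Projectivization.mk K _ hne, _, hne, hA.one_mem, rfl⟩, ?_⟩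
  rw [Pi.zero_apply, projEval_ne_zero_iff hf, MvPolynomial.eval_X]
  obtain ⟨a, ha⟩ := Projectivization.exists_smul_eq_mk_rep K _ hne
  simp [← ha, Units.smul_def]

theorem codeMinDist_projReedMullerCode_one {K : Type*} [Field K] [Finite K] {n : ℕ}
    {A : Fin (n + 1) → Finset K} (hA : IsProjNested A)
    {f : projCartesianSet A → MvPolynomial (Fin (n + 1)) K}
    (hf : IsDenominatorFamily (projCartesianSet A) 1 f) :
    codeMinDist (projReedMullerCode (projCartesianSet A) 1 f)
      = ∏ i : Fin n, (A i.succ).card := by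
  classical
  let := Fintype.ofFinite (projCartesianSet A)
  have hmem := projEval_X_zero_ne_zero hA hf
  rw [codeMinDist]
  refine le_antisymm ?_ (le_csInf ⟨_, _, ⟨_, rfl⟩, hmem, rfl⟩ ?_)
  · refine le_trans (Nat.sInf_le ⟨_, LinearMap.mem_range_self _ _, hmem, rfl⟩) ?_
    convert hammingNorm_projEval_X_zero_le hA hf
  · rintro w ⟨_, ⟨g, rfl⟩, hg, rfl⟩
    convert prod_card_le_hammingNorm_projEval hA hf g hg

theorem Fin.prod_filter_one_le_val {M : Type*} [CommMonoid M] {n : ℕ} (u : Fin (n + 1) → M) :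
    ∏ i with 1 ≤ i.val, u i = ∏ i : Fin n, u i.succ := by
  rw [Finset.prod_filter, Fin.prod_univ_succ]
  simp

theorem Fin.prod_filter_two_le_val {M : Type*} [CommMonoid M] {n : ℕ} (u : Fin (n + 2) → M) :
    ∏ i with 2 ≤ i.val, u i = ∏ i : Fin n, u i.succ.succ := by
  rw [Finset.prod_filter, Fin.prod_univ_succ, Fin.prod_univ_succ]
  simp

/-- For `s = 1` the sum is empty, so degree `1` is in the second range with value `1`. For `s ≥ 2`
the first range applies with `k = 0`, `ℓ = 1`, where `d_2 - ℓ + 1 = d_2`. -/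
theorem isConjecturedMinDist_one {n : ℕ} (u : Fin (n + 1) → ℕ) (hu : ∀ i, 2 ≤ u i) :
    IsConjecturedMinDist u 1 (∏ i : Fin n, u i.succ) := by
  cases n with
  | zero => exact ⟨fun h => by simp at h, fun _ => by simp⟩
  | succ n =>
    have h1 : 2 ≤ u ⟨1, by omega⟩ := hu _
    refine ⟨fun _ => ⟨0, 1, by omega, ?_, le_rfl, by simp only [zero_add]; omega, ?_⟩, fun h => ?_⟩
    · rw [Finset.sum_eq_zero]
      intro i hi
      have := (Finset.mem_filter.mp hi).2
      omega
    · rw [Fin.prod_filter_two_le_val, Fin.prod_univ_succ]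
      simp only [zero_add]
      rw [Nat.sub_add_cancel (by omega)]
      rfl
    -- The second range would force `d_2 - 1 = 0`, against `d_2 ≥ 2`.
    · have := Finset.sum_eq_zero_iff.mp (Nat.le_zero.mp (Nat.le_of_succ_le_succ h)) ⟨1, by omega⟩
        (by simp)
      omega

theorem mainTheorem8 {K : Type*} [Field K] [Finite K] {s : ℕ} (hs : 1 ≤ s)
    (A : Fin s → Finset K) (hA : IsProjNested A)
    (f : projCartesianSet A → MvPolynomial (Fin s) K)
    (hf : IsDenominatorFamily (projCartesianSet A) 1 f) :
    codeMinDist (projReedMullerCode (projCartesianSet A) 1 f)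
        = ∏ i with 1 ≤ i.val, (A i).card ∧
      IsConjecturedMinDist (fun i => (A i).card) 1
        (codeMinDist (projReedMullerCode (projCartesianSet A) 1 f)) := by
  obtain ⟨n, rfl⟩ : ∃ n, s = n + 1 := ⟨s - 1, by omega⟩
  rw [Fin.prod_filter_one_le_val, codeMinDist_projReedMullerCode_one hA hf]
  exact ⟨rfl, isConjecturedMinDist_one _ fun i =>
    Finset.one_lt_card.mpr ⟨0, hA.zero_mem i, 1, hA.one_mem i, zero_ne_one⟩⟩
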